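/- Conventions. A weighted polyhedral complex $X\subset\mathbb{R}^2$ pure of dimension $1$ is a finite polyhedral complex in $\mathbb{R}^2$ (possibly empty), every cell of which is contained in a $1$-dimensional cell and none of which has dimension $2$, together with a weight $w_X(\sigma)>0$ for each $1$-dimensional (maximal) cell $\sigma$. It is balanced if at every vertex $p$ one has $\sum_{\sigma\ni p}w_X(\sigma)\,u_{\sigma,p}=0$, the sum being over the maximal cells $\sigma$ containing $p$, where $u_{\sigma,p}$ is the Euclidean unit vector pointing from $p$ into $\sigma$. The monomial length $\mathrm{mlen}(X)$ of a balanced $X$ is the number of connected components of $\mathbb{R}^2\setminus |X|$. A sum of weighted complexes is their union with the weights added, after passing to a common refinement. If a balanced complex is presented as a sum (a factorization) $Y=Y_1+\dots+Y_m$ of balanced complexes $Y_i$, its factorization length is $$\mathrm{flen}(Y)=\sum_{i=1}^m \mathrm{mlen}(Y_i)-(m-1).$$ A balancing of $X$ with respect to the factorization length is a balanced complex $Y=Y_1+\dots+Y_m$ so presented with $w_X\le w_Y$ on every maximal cell of a common refinement of $X$ and $Y$ (where $w_Y=0$ off $Y$, so that $|X|\subset|Y|$); it is minimal if $\mathrm{flen}(Y)\le\mathrm{flen}(Z)$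 for every such balancing $Z=Z_1+\dots+Z_k$ of $X$. The canonical arrangement $\mathcal{A}_X$ is the sum $L_1+\dots+L_k$ of the distinct lines $L_1,\dots,L_k$ that are affine spans of maximal cells of $X$, presented by this factorization, each $L_j$ being weighted by the maximum of the weights of the maximal cells of $X$ lying on $L_j$. Proposition. Let $X\subset\mathbb{R}^2$ be a weighted polyhedral complex pure of dimension $1$ (with positive weights), and let $\mathcal{V}$ be a minimal balancing of $X$ with respect to the factorization length. Then $$\mathrm{flen}(\mathcal{A}_X)\le 3\,\mathrm{flen}(\mathcal{V}).$$ -/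

import Mathlib

namespace PlaneComplex

open Filter

/-- The Euclidean plane. -/
abbrev Plane : Type := EuclideanSpace ℝ (Fin 2)

/-- A polyhedron: the intersection of finitely many closed half-planes `⟪a, x⟫ ≤ b`. -/
def IsPolyhedron (P : Set Plane) : Prop :=
  ∃ H : Finset (Plane × ℝ), P = {x | ∀ h ∈ H, inner ℝ h.1 x ≤ h.2}

/-- The dimension of (the affine span of) a nonempty set. -/
noncomputable def dim (P : Set Plane) : ℕ := Module.finrank ℝ (vectorSpan ℝ P)

/-- A weighted polyhedral complex in the plane, pure of dimension `1`, with positive weights: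
a finite set of nonempty polyhedra that is closed under taking nonempty faces and in which
any two cells that meet do so in a common face. (A nonempty face is the locus where a linear
functional attains its maximum, i.e. a nonempty exposed subset.) Only the values of `weight` on
the one-dimensional cells are ever used. The complex may be empty. -/
structure WeightedComplex where
  cells : Finset (Set Plane)
  isPolyhedron : ∀ P ∈ cells, IsPolyhedron P
  nonempty : ∀ P ∈ cells, P.Nonempty
  face_mem : ∀ P ∈ cells, ∀ F : Set Plane, F.Nonempty → IsExposed ℝ P F → F ∈ cells
  inter_face : ∀ P ∈ cells, ∀ Q ∈ cells, (P ∩ Q).Nonempty →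
    IsExposed ℝ P (P ∩ Q) ∧ IsExposed ℝ Q (P ∩ Q)
  dim_le : ∀ P ∈ cells, dim P ≤ 1
  isPure : ∀ P ∈ cells, ∃ Q ∈ cells, P ⊆ Q ∧ dim Q = 1
  weight : Set Plane → ℝ
  weight_pos : ∀ P ∈ cells, dim P = 1 → 0 < weight P

namespace WeightedComplex

open Classical in
/-- The maximal cells, i.e. the one-dimensional ones. -/
noncomputable def maxCells (X : WeightedComplex) : Finset (Set Plane) :=
  {P ∈ X.cells | dim P = 1}

/-- The support: the union of the maximal cells. -/
def support (X : WeightedComplex) : Set Plane := ⋃ P ∈ X.maxCells, P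

open Classical in
/-- The weight of a complex at a point. Off the finitely many vertices this is the weight of the
unique maximal cell containing `x`, and `0` if there is none. -/
noncomputable def weightAt (X : WeightedComplex) (x : Plane) : ℝ :=
  ∑ P ∈ X.maxCells with x ∈ P, X.weight P

open Classical in
/-- The balancing condition: at every vertex `p`, the primitive (unit) vectors pointing from `p`
into the adjacent maximal cells, multiplied by the weights of these cells, add up to zero.
(As `p` is an endpoint of each of these cells, the unit vectors are uniquely determined.) -/
def IsBalanced (X : WeightedComplex) : Prop :=
  ∀ p : Plane, {p} ∈ X.cells → ∃ u : Set Plane → Plane,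
    (∀ P ∈ X.maxCells, p ∈ P → ‖u P‖ = 1 ∧ ∃ t : ℝ, 0 < t ∧ p + t • u P ∈ P) ∧
    ∑ P ∈ X.maxCells with p ∈ P, X.weight P • u P = 0

/-- The monomial length: the number of regions (connected components of the complement of the
support) into which the complex divides the plane. -/
noncomputable def mlen (X : WeightedComplex) : ℕ :=
  Nat.card (ConnectedComponents ↥(X.supportᶜ))

end WeightedComplex

/-- A balanced complex presented as a sum `Y₁ + ⋯ + Yₘ` of balanced complexes
(a factorization). -/
structure Factorization where
  factors : Multiset WeightedComplex
  balanced : ∀ Y ∈ factors, Y.IsBalanced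

namespace Factorization

/-- The weight of the sum `Y₁ + ⋯ + Yₘ` at a point (meaningful off finitely many points): the
weight function of a sum is the sum of the weight functions on a common refinement. -/
noncomputable def weightAt (Y : Factorization) (x : Plane) : ℝ :=
  (Y.factors.map fun Z => Z.weightAt x).sum

/-- The factorization length `∑ᵢ mlen Yᵢ - (m - 1)`. -/
noncomputable def flen (Y : Factorization) : ℤ :=
  (Y.factors.map fun Z => (Z.mlen : ℤ)).sum - ((Multiset.card Y.factors : ℤ) - 1)

/-- `Y = Y₁ + ⋯ + Yₘ` is a balancing of `X`: `w_X ≤ w_Y` on every maximal cell of a common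
refinement, i.e. at all but finitely many points of the plane. -/
def IsBalancingOf (Y : Factorization) (X : WeightedComplex) : Prop :=
  ∀ᶠ x in cofinite, X.weightAt x ≤ Y.weightAt x

/-- A minimal balancing with respect to the factorization length. -/
def IsMinimalBalancingOf (Y : Factorization) (X : WeightedComplex) : Prop :=
  Y.IsBalancingOf X ∧ ∀ Z : Factorization, Z.IsBalancingOf X → Y.flen ≤ Z.flen

end Factorization

theorem dim_line {L : AffineSubspace ℝ Plane} :
    dim (L : Set Plane) = Module.finrank ℝ L.direction := by
  rw [dim, AffineSubspace.direction_eq_vectorSpan]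

theorem nonempty_line {L : AffineSubspace ℝ Plane}
    (hL : Module.finrank ℝ L.direction = 1) : (L : Set Plane).Nonempty := by
  rw [AffineSubspace.nonempty_iff_ne_bot]
  rintro rfl
  rw [AffineSubspace.direction_bot, finrank_bot] at hL
  exact zero_ne_one hL

theorem eq_of_isExposed_line {L : AffineSubspace ℝ Plane} {F : Set Plane}
    (hF : F.Nonempty) (h : IsExposed ℝ (L : Set Plane) F) : F = L := by
  obtain ⟨l, rfl⟩ := h hF
  obtain ⟨x, hx, hmax⟩ := hF
  have key : ∀ y ∈ L, l y = l x := by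
    intro y hy
    apply le_antisymm (hmax y hy)
    have h2 : (x -ᵥ y) +ᵥ x ∈ L :=
      AffineSubspace.vadd_mem_of_mem_direction (L.vsub_mem_direction hx hy) hx
    have h3 := hmax _ h2
    simp only [vsub_eq_sub, vadd_eq_add, map_add, map_sub] at h3
    linarith
  ext y
  simp only [Set.mem_ofPred_eq, SetLike.mem_coe]
  constructor
  · exact fun hy => hy.1
  · exact fun hy => ⟨hy, fun z hz => by rw [key y hy, key z hz]⟩

theorem isPolyhedron_line {L : AffineSubspace ℝ Plane}
    (hL : Module.finrank ℝ L.direction = 1) : IsPolyhedron (L : Set Plane) := by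
  classical
  obtain ⟨p, hp⟩ := nonempty_line hL
  have h1 : Module.finrank ℝ L.directionᗮ = 1 := by
    have := L.direction.finrank_add_finrank_orthogonal
    rw [hL, finrank_euclideanSpace_fin] at this
    omega
  obtain ⟨n, -, hn⟩ := finrank_eq_one_iff'.mp h1
  have hmem : ∀ v : Plane, v ∈ L.direction ↔ inner ℝ (n : Plane) v = 0 := by
    intro v
    constructor
    · intro hv
      exact Submodule.inner_left_of_mem_orthogonal hv n.2
    · intro hv
      rw [← Submodule.orthogonal_orthogonal L.direction, Submodule.mem_orthogonal]
      intro w hw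
      obtain ⟨c, hc⟩ := hn ⟨w, hw⟩
      have : w = c • (n : Plane) := by
        rw [← Submodule.coe_smul, hc]
      rw [this, inner_smul_left, hv, mul_zero]
  refine ⟨{((n : Plane), inner ℝ (n : Plane) p), (-(n : Plane), -inner ℝ (n : Plane) p)}, ?_⟩
  ext x
  have hx : x ∈ L ↔ x -ᵥ p ∈ L.direction :=
    (AffineSubspace.vsub_right_mem_direction_iff_mem hp x).symm
  simp only [SetLike.mem_coe, Set.mem_ofPred_eq, Finset.mem_insert, Finset.mem_singleton,
    forall_eq_or_imp, forall_eq, inner_neg_left, hx, hmem, vsub_eq_sub, inner_sub_right]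
  constructor
  · intro h
    constructor <;> linarith
  · rintro ⟨h2, h3⟩
    linarith

/-- A line with a positive weight, as a complex with a single cell. -/
def lineComplex (L : AffineSubspace ℝ Plane) (hL : Module.finrank ℝ L.direction = 1)
    (w : ℝ) (hw : 0 < w) : WeightedComplex where
  cells := {(L : Set Plane)}
  isPolyhedron P hP := by
    rw [Finset.mem_singleton.mp hP]
    exact isPolyhedron_line hL
  nonempty P hP := by
    rw [Finset.mem_singleton.mp hP]
    exact nonempty_line hL
  face_mem P hP F hF h := by
    rw [Finset.mem_singleton] at hP ⊢
    subst hP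
    exact eq_of_isExposed_line hF h
  inter_face P hP Q hQ _ := by
    rw [Finset.mem_singleton] at hP hQ
    subst hP hQ
    rw [Set.inter_self]
    exact ⟨IsExposed.refl _, IsExposed.refl _⟩
  dim_le P hP := by
    rw [Finset.mem_singleton.mp hP, dim_line, hL]
  isPure P hP := ⟨P, hP, subset_rfl, by rw [Finset.mem_singleton.mp hP, dim_line, hL]⟩
  weight _ := w
  weight_pos _ _ _ := hw

theorem lineComplex_isBalanced (L : AffineSubspace ℝ Plane)
    (hL : Module.finrank ℝ L.direction = 1) (w : ℝ) (hw : 0 < w) :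
    (lineComplex L hL w hw).IsBalanced := by
  intro p hp
  exfalso
  have h : ({p} : Set Plane) = L := Finset.mem_singleton.mp hp
  have h2 : dim ({p} : Set Plane) = 1 := by rw [h, dim_line, hL]
  rw [dim, vectorSpan_singleton, finrank_bot] at h2
  exact zero_ne_one h2

namespace WeightedComplex

open Classical in
/-- The set of the (pairwise distinct) lines that are affine spans of maximal cells. -/
noncomputable def spanLines (X : WeightedComplex) : Finset (AffineSubspace ℝ Plane) :=
  X.maxCells.image (affineSpan ℝ)

theorem finrank_of_mem_spanLines {X : WeightedComplex} {L : AffineSubspace ℝ Plane}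
    (hL : L ∈ X.spanLines) : Module.finrank ℝ L.direction = 1 := by
  classical
  obtain ⟨P, hP, rfl⟩ := Finset.mem_image.mp hL
  rw [direction_affineSpan]
  exact (Finset.mem_filter.mp hP).2

open Classical in
/-- The maximal cells that lie on, and hence span, a given line. -/
noncomputable def cellsOn (X : WeightedComplex) (L : AffineSubspace ℝ Plane) :
    Finset (Set Plane) :=
  {P ∈ X.maxCells | affineSpan ℝ P = L}

theorem cellsOn_nonempty {X : WeightedComplex} {L : AffineSubspace ℝ Plane}
    (hL : L ∈ X.spanLines) : (X.cellsOn L).Nonempty := by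
  classical
  obtain ⟨P, hP, h⟩ := Finset.mem_image.mp hL
  exact ⟨P, Finset.mem_filter.mpr ⟨hP, h⟩⟩

/-- The weight of a line of the canonical arrangement: the largest weight of a maximal cell
on it. -/
noncomputable def lineWeight (X : WeightedComplex) (L : AffineSubspace ℝ Plane)
    (hL : L ∈ X.spanLines) : ℝ :=
  (X.cellsOn L).sup' (cellsOn_nonempty hL) X.weight

theorem lineWeight_pos {X : WeightedComplex} {L : AffineSubspace ℝ Plane}
    (hL : L ∈ X.spanLines) : 0 < X.lineWeight L hL := by
  classical
  obtain ⟨P, hP⟩ := cellsOn_nonempty hL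
  rw [lineWeight, Finset.lt_sup'_iff]
  have h := Finset.mem_filter.mp (Finset.mem_filter.mp hP).1
  exact ⟨P, hP, X.weight_pos P h.1 h.2⟩

/-- The canonical arrangement of `X`: the sum of the affine spans of its maximal cells, each line
taken once. -/
noncomputable def canonicalArrangement (X : WeightedComplex) : Factorization where
  factors := X.spanLines.attach.val.map fun L =>
    lineComplex L.1 (finrank_of_mem_spanLines L.2) (X.lineWeight L.1 L.2) (lineWeight_pos L.2)
  balanced Y hY := by
    obtain ⟨L, -, rfl⟩ := Multiset.mem_map.mp hY
    exact lineComplex_isBalanced _ _ _ _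

end WeightedComplex

end PlaneComplex

/-! ### Sheared coordinates: one-dimensional cells as graphs over intervals. -/

namespace PlaneComplex

open Filter Topology

/-! Every line in `X.spanLines` is also spanned by a cell of some factor of `V`, since up to
finitely many points a cell of `X` is covered by the finitely many cells of the factors. A line cuts
the plane into at most two regions, so an arrangement of k lines has factorization length at most 2k
- (k - 1) = k + 1. Hence it suffices that a balanced complex Z spans at most 3 mlen Z - 3 lines
(`IsBalanced.card_spanLines_le`): summed over the factors this gives k + 3 ≤ 3 flen V.

For that bound let E, N, F be the numbers of maximal cells, of vertices, and of vertices of degree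
two. Three inequalities are combined: E + 1 ≤ mlen + N (Euler, `card_maxCells_lt`); 3N ≤ 2E + F, by
counting cell ends, as balancing excludes degree one (`IsBalanced.card_verts_le`); and lines + F ≤
E, as cells meeting at a vertex of degree two are collinear (`IsBalanced.card_spanLines_add_le`).
Thus 3 mlen ≥ 3E + 3 - 3N ≥ E - F + 3 ≥ lines + 3.

Euler's inequality is obtained by linear algebra. Flows, the real functions on the maximal cells
with zero net incidence at each vertex, form a space of dimension at least E - N. The sum of a flow
over the cells below a point is locally constant off the support and jumps across a cell by the
value of the flow there. So flows together with constants embed into the functions on the regions,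
whence E - N + 1 ≤ mlen. -/

/-- The abscissa in the sheared coordinates `(x₀ + s x₁, x₁)` of the plane. -/
noncomputable def absc (s : ℝ) : Plane →L[ℝ] ℝ :=
  EuclideanSpace.proj 0 + s • EuclideanSpace.proj 1

theorem absc_apply (s : ℝ) (x : Plane) : absc s x = x 0 + s * x 1 := by
  simp [absc]

/-- The point with given sheared coordinates. -/
noncomputable def shearPoint (s t y : ℝ) : Plane := !₂[t - s * y, y]

@[simp] theorem absc_shearPoint (s t y : ℝ) : absc s (shearPoint s t y) = t := by
  simp [absc_apply, shearPoint]

@[simp] theorem shearPoint_one (s t y : ℝ) : shearPoint s t y 1 = y := by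
  simp [shearPoint]

theorem ext_absc (s : ℝ) {x y : Plane} (h : absc s x = absc s y) (h1 : x 1 = y 1) : x = y := by
  rw [absc_apply, absc_apply, h1] at h
  ext i
  fin_cases i
  · simpa using h
  · exact h1

@[simp] theorem shearPoint_absc (s : ℝ) (x : Plane) : shearPoint s (absc s x) (x 1) = x :=
  ext_absc s (by simp) (by simp)

theorem continuous_coord_one : Continuous fun x : Plane => x 1 :=
  (EuclideanSpace.proj 1 : Plane →L[ℝ] ℝ).continuous

theorem continuous_shearPoint (s : ℝ) : Continuous fun q : ℝ × ℝ => shearPoint s q.1 q.2 := by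
  refine (PiLp.continuous_toLp 2 _).comp ?_
  refine continuous_pi fun i => ?_
  fin_cases i <;> simp <;> fun_prop

theorem IsPolyhedron.isClosed {P : Set Plane} (hP : IsPolyhedron P) : IsClosed P := by
  obtain ⟨H, rfl⟩ := hP
  have : {x : Plane | ∀ h ∈ H, inner ℝ h.1 x ≤ h.2} = ⋂ h ∈ H, {x | inner ℝ h.1 x ≤ h.2} := by
    ext; simp
  rw [this]
  exact isClosed_biInter fun h _ => isClosed_le (by fun_prop) continuous_const

theorem IsPolyhedron.convex {P : Set Plane} (hP : IsPolyhedron P) : Convex ℝ P := by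
  obtain ⟨H, rfl⟩ := hP
  have : {x : Plane | ∀ h ∈ H, inner ℝ h.1 x ≤ h.2} = ⋂ h ∈ H, {x | inner ℝ h.1 x ≤ h.2} := by
    ext; simp
  rw [this]
  exact convex_iInter₂ fun h _ => convex_halfSpace_le (innerSL ℝ h.1).toLinearMap.isLinear _

/-- `P` is, in the sheared coordinates, the graph of the function `t ↦ α t + β` over a closed
interval that is not a point. -/
structure IsGraph (s : ℝ) (P : Set Plane) (α β : ℝ) : Prop where
  isClosed : IsClosed (absc s '' P)
  ordConnected : (absc s '' P).OrdConnected
  nontrivial : (absc s '' P).Nontrivial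
  mem_iff : ∀ x, x ∈ P ↔ absc s x ∈ absc s '' P ∧ x 1 = α * absc s x + β

theorem isGraph_of_isPolyhedron {s : ℝ} {P : Set Plane} (hP : IsPolyhedron P) (hd : dim P = 1)
    (hs : ∀ v ∈ vectorSpan ℝ P, absc s v = 0 → v = 0) : ∃ α β, IsGraph s P α β := by
  have hnt : P.Nontrivial := by
    rw [← Set.not_subsingleton_iff]
    intro h
    rw [dim, vectorSpan_of_subsingleton ℝ h, finrank_bot] at hd
    exact zero_ne_one hd
  obtain ⟨p, hp⟩ := hnt.nonempty
  obtain ⟨⟨v, hv⟩, hv0, hspan⟩ := finrank_eq_one_iff'.mp hd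
  have hv0' : absc s v ≠ 0 := fun h => hv0 (Subtype.ext (hs v hv h))
  have hval : ∀ x ∈ P, x 1 = v 1 / absc s v * absc s x + (p 1 - v 1 / absc s v * absc s p) := by
    intro x hx
    obtain ⟨r, hr⟩ := hspan ⟨x -ᵥ p, vsub_mem_vectorSpan ℝ hx hp⟩
    have hr' : x = r • v + p := by
      have := congrArg Subtype.val hr
      simp only [vsub_eq_sub, Submodule.coe_smul] at this
      rw [this, sub_add_cancel]
    rw [hr']
    simp only [map_add, map_smul, smul_eq_mul, PiLp.add_apply, PiLp.smul_apply]
    field_simp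
    ring
  set α := v 1 / absc s v
  set β := p 1 - α * absc s p
  have hmem : ∀ x, x ∈ P ↔ absc s x ∈ absc s '' P ∧ x 1 = α * absc s x + β := by
    refine fun x => ⟨fun hx => ⟨⟨x, hx, rfl⟩, hval x hx⟩, ?_⟩
    rintro ⟨⟨y, hy, hyx⟩, hx⟩
    rwa [ext_absc s hyx.symm (by rw [hx, hval y hy, hyx])]
  refine ⟨α, β, ?_, ?_, ?_, hmem⟩
  -- The interval is the preimage of the closed set `P` under the parametrization of its line by
  -- abscissa.
  · have : absc s '' P = (fun t => shearPoint s t (α * t + β)) ⁻¹' P := by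
      ext t
      constructor
      · rintro ⟨x, hx, rfl⟩
        simpa [← hval x hx] using hx
      · intro h
        exact ⟨_, h, by simp⟩
    rw [this]
    exact hP.isClosed.preimage ((continuous_shearPoint s).comp (by fun_prop :
      Continuous fun t : ℝ => (t, α * t + β)))
  · exact (hP.convex.linear_image (absc s).toLinearMap).ordConnected
  · obtain ⟨x, hx, y, hy, hxy⟩ := hnt
    refine ⟨_, ⟨x, hx, rfl⟩, _, ⟨y, hy, rfl⟩, fun h => hxy (ext_absc s h ?_)⟩
    rw [hval x hx, hval y hy, h]

namespace IsGraph

variable {s α β : ℝ} {P : Set Plane}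

theorem coord_one (h : IsGraph s P α β) {x : Plane} (hx : x ∈ P) : x 1 = α * absc s x + β :=
  ((h.mem_iff x).mp hx).2

theorem injOn (h : IsGraph s P α β) : Set.InjOn (absc s) P := fun x hx y hy hxy =>
  ext_absc s hxy (by rw [h.coord_one hx, h.coord_one hy, hxy])

theorem shearPoint_mem (h : IsGraph s P α β) {t : ℝ} (ht : t ∈ absc s '' P) :
    shearPoint s t (α * t + β) ∈ P := by
  rw [h.mem_iff]
  simpa using ht

theorem not_isLeast_and_isGreatest (h : IsGraph s P α β) {t : ℝ}
    (h1 : IsLeast (absc s '' P) t) (h2 : IsGreatest (absc s '' P) t) : False := by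
  obtain ⟨a, ha, b, hb, hab⟩ := h.nontrivial
  exact hab (by rw [le_antisymm (h2.2 ha) (h1.2 ha), le_antisymm (h2.2 hb) (h1.2 hb)])

theorem isClosed_set (h : IsGraph s P α β) : IsClosed P := by
  have : P = absc s ⁻¹' (absc s '' P) ∩ {x | x 1 = α * absc s x + β} := by
    ext x
    exact h.mem_iff x
  rw [this]
  exact (h.isClosed.preimage (absc s).continuous).inter
    (isClosed_eq continuous_coord_one (by fun_prop))

/-- On `P` a linear functional is affine in the abscissa. The sign of its slope `a` decides whether
the exposed face is the left end, all of `P`, or the right end. -/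
theorem face (h : IsGraph s P α β) {F : Set Plane} (hF : IsExposed ℝ P F) (hne : F.Nonempty) :
    F = P ∨ ∃ p ∈ P, F = {p} ∧
      (IsLeast (absc s '' P) (absc s p) ∨ IsGreatest (absc s '' P) (absc s p)) := by
  obtain ⟨l, rfl⟩ := hF hne
  have hl : ∀ x ∈ P, ∀ y ∈ P, l x - l y =
      (l (shearPoint s 1 α) - l (shearPoint s 0 0)) * (absc s x - absc s y) := by
    intro x hx y hy
    rw [← map_sub, ← map_sub, mul_comm, ← smul_eq_mul, ← map_smul]
    congr 1
    apply ext_absc s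
    · simp
    · simp [h.coord_one hx, h.coord_one hy]
      ring
  set a := l (shearPoint s 1 α) - l (shearPoint s 0 0)
  obtain ⟨p, hp, hmax⟩ := hne
  have key : IsLeast (absc s '' P) (absc s p) ∨ IsGreatest (absc s '' P) (absc s p) →
      a ≠ 0 → {x ∈ P | ∀ y ∈ P, l y ≤ l x} = {p} := by
    intro _ ha
    ext x
    simp only [Set.mem_ofPred_eq, Set.mem_singleton_iff]
    constructor
    · rintro ⟨hx, hx'⟩
      have h1 := hl x hx p hp
      rw [le_antisymm (hmax x hx) (hx' p hp), sub_self, eq_comm, mul_eq_zero] at h1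
      exact h.injOn hx hp (sub_eq_zero.mp (h1.resolve_left ha))
    · rintro rfl
      exact ⟨hp, hmax⟩
  rcases lt_trichotomy a 0 with ha | ha | ha
  · have hL : IsLeast (absc s '' P) (absc s p) := by
      refine ⟨⟨p, hp, rfl⟩, ?_⟩
      rintro _ ⟨y, hy, rfl⟩
      have := hl y hy p hp
      by_contra hlt
      have := hmax y hy
      nlinarith
    exact Or.inr ⟨p, hp, key (Or.inl hL) ha.ne, Or.inl hL⟩
  · left
    ext x
    refine ⟨fun hx => hx.1, fun hx => ⟨hx, fun y hy => ?_⟩⟩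
    have := hl y hy x hx
    rw [ha, zero_mul] at this
    linarith
  · have hL : IsGreatest (absc s '' P) (absc s p) := by
      refine ⟨⟨p, hp, rfl⟩, ?_⟩
      rintro _ ⟨y, hy, rfl⟩
      have := hl y hy p hp
      by_contra hlt
      have := hmax y hy
      nlinarith
    exact Or.inr ⟨p, hp, key (Or.inr hL) ha.ne', Or.inr hL⟩

theorem isExposed_of_isGreatest (h : IsGraph s P α β) {p : Plane} (hp : p ∈ P)
    (hL : IsGreatest (absc s '' P) (absc s p)) : IsExposed ℝ P {p} := by
  refine fun _ => ⟨absc s, ?_⟩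
  ext x
  simp only [Set.mem_ofPred_eq, Set.mem_singleton_iff]
  constructor
  · rintro rfl
    exact ⟨hp, fun y hy => hL.2 ⟨y, hy, rfl⟩⟩
  · rintro ⟨hx, hx'⟩
    exact h.injOn hx hp (le_antisymm (hL.2 ⟨x, hx, rfl⟩) (hx' p hp))

theorem isExposed_of_isLeast (h : IsGraph s P α β) {p : Plane} (hp : p ∈ P)
    (hL : IsLeast (absc s '' P) (absc s p)) : IsExposed ℝ P {p} := by
  refine fun _ => ⟨-absc s, ?_⟩
  ext x
  simp only [Set.mem_ofPred_eq, Set.mem_singleton_iff, neg_apply,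
    neg_le_neg_iff]
  constructor
  · rintro rfl
    exact ⟨hp, fun y hy => hL.2 ⟨y, hy, rfl⟩⟩
  · rintro ⟨hx, hx'⟩
    exact h.injOn hx hp (le_antisymm (hx' p hp) (hL.2 ⟨x, hx, rfl⟩))

end IsGraph

/-- Dropping the right end of the interval makes membership locally constant to the right, so a cell
can appear or disappear only on passing to the left of `t₀`. -/
theorem eventually_ge_mem_rightOpen {I : Set ℝ} (hc : IsClosed I) (ho : I.OrdConnected) (t₀ : ℝ) :
    ∀ᶠ t in 𝓝[≥] t₀, ((t ∈ I ∧ ∃ t' ∈ I, t < t') ↔ (t₀ ∈ I ∧ ¬ IsGreatest I t₀)) := by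
  by_cases h : t₀ ∈ I
  · by_cases hg : IsGreatest I t₀
    · filter_upwards [self_mem_nhdsWithin] with t ht
      simp only [hg, not_true_eq_false, and_false, iff_false]
      rintro ⟨-, t', ht', hlt⟩
      exact absurd (hg.2 ht') (not_le.mpr (lt_of_le_of_lt ht hlt))
    · have : ∃ t' ∈ I, t₀ < t' := by
        by_contra! hn
        exact hg ⟨h, hn⟩
      obtain ⟨t', ht', hlt⟩ := this
      filter_upwards [self_mem_nhdsWithin, mem_nhdsWithin_of_mem_nhds (Iio_mem_nhds hlt)]
        with t ht hlt'
      simp only [h, hg, not_false_eq_true, and_self, iff_true]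
      exact ⟨ho.out h ht' ⟨ht, le_of_lt hlt'⟩, t', ht', hlt'⟩
  · filter_upwards [mem_nhdsWithin_of_mem_nhds (hc.isOpen_compl.mem_nhds h)] with t ht
    simp only [h, false_and, iff_false]
    exact fun h' => ht h'.1

theorem eventually_lt_mem_rightOpen {I : Set ℝ} (hc : IsClosed I) (ho : I.OrdConnected) (t₀ : ℝ) :
    ∀ᶠ t in 𝓝[<] t₀, ((t ∈ I ∧ ∃ t' ∈ I, t < t') ↔ (t₀ ∈ I ∧ ¬ IsLeast I t₀)) := by
  by_cases h : t₀ ∈ I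
  · by_cases hg : IsLeast I t₀
    · filter_upwards [self_mem_nhdsWithin] with t ht
      simp only [hg, not_true_eq_false, and_false, iff_false]
      rintro ⟨ht', -⟩
      exact absurd (hg.2 ht') (not_le.mpr ht)
    · have : ∃ t' ∈ I, t' < t₀ := by
        by_contra! hn
        exact hg ⟨h, hn⟩
      obtain ⟨t', ht', hlt⟩ := this
      filter_upwards [self_mem_nhdsWithin, mem_nhdsWithin_of_mem_nhds (Ioi_mem_nhds hlt)]
        with t ht hlt'
      simp only [h, hg, not_false_eq_true, and_self, iff_true]
      exact ⟨ho.out ht' h ⟨le_of_lt hlt', le_of_lt ht⟩, t₀, h, ht⟩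
  · filter_upwards [mem_nhdsWithin_of_mem_nhds (hc.isOpen_compl.mem_nhds h)] with t ht
    simp only [h, false_and, iff_false]
    exact fun h' => ht h'.1

end PlaneComplex

/-! ### Flows on the cells and the functions they induce off the support. -/

namespace PlaneComplex

open Filter Topology

namespace WeightedComplex

theorem mem_maxCells {X : WeightedComplex} {P : Set Plane} :
    P ∈ X.maxCells ↔ P ∈ X.cells ∧ dim P = 1 := by
  classical
  exact Finset.mem_filter

/-- A cell rules out at most one `s`: its direction `w` is killed only when `w 0 + s * w 1 = 0`,
which has no solution if `w 1 = 0`. Finitely many cells therefore leave a common shear. -/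
theorem exists_isGraph (X : WeightedComplex) :
    ∃ (s : ℝ) (α β : Set Plane → ℝ), ∀ P ∈ X.maxCells, IsGraph s P (α P) (β P) := by
  classical
  have h1 : ∀ P ∈ X.maxCells, {s : ℝ | ∃ v ∈ vectorSpan ℝ P, v ≠ 0 ∧ absc s v = 0}.Finite := by
    intro P hP
    refine Set.Subsingleton.finite ?_
    obtain ⟨⟨w, hw⟩, hw0, hspan⟩ := finrank_eq_one_iff'.mp (mem_maxCells.mp hP).2
    have key : ∀ s, (∃ v ∈ vectorSpan ℝ P, v ≠ 0 ∧ absc s v = 0) → w 0 + s * w 1 = 0 := by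
      rintro s ⟨v, hv, hv0, hs⟩
      obtain ⟨r, hr⟩ := hspan ⟨v, hv⟩
      have hr' : r • w = v := congrArg Subtype.val hr
      have hr0 : r ≠ 0 := by
        rintro rfl
        exact hv0 (by rw [← hr', zero_smul])
      rw [← hr', map_smul, smul_eq_mul, absc_apply] at hs
      exact (mul_eq_zero.mp hs).resolve_left hr0
    intro s hs t ht
    have hs' := key s hs
    have ht' := key t ht
    have hw1 : w 1 ≠ 0 := by
      intro h
      rw [h, mul_zero, add_zero] at hs'
      refine hw0 (Subtype.ext ?_)
      ext i
      fin_cases i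
      · exact hs'
      · exact h
    exact mul_right_cancel₀ hw1 (by linarith)
  have h2 : (⋃ P ∈ X.maxCells, {s : ℝ | ∃ v ∈ vectorSpan ℝ P, v ≠ 0 ∧ absc s v = 0}).Finite :=
    Set.Finite.biUnion X.maxCells.finite_toSet h1
  obtain ⟨s, hs⟩ := h2.exists_notMem
  simp only [Set.mem_iUnion, Set.mem_ofPred_eq, not_exists, not_and] at hs
  have h3 : ∀ P, ∃ q : ℝ × ℝ, P ∈ X.maxCells → IsGraph s P q.1 q.2 := by
    intro P
    by_cases hP : P ∈ X.maxCells
    · obtain ⟨α, β, h⟩ := isGraph_of_isPolyhedron (s := s)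
        (X.isPolyhedron P (mem_maxCells.mp hP).1) (mem_maxCells.mp hP).2
        (fun v hv h0 => by_contra fun hne => hs P hP v hv hne h0)
      exact ⟨(α, β), fun _ => h⟩
    · exact ⟨0, fun h => absurd h hP⟩
  choose q hq using h3
  exact ⟨s, fun P => (q P).1, fun P => (q P).2, hq⟩

/-- The vertices of a complex. -/
noncomputable def verts (X : WeightedComplex) : Finset Plane :=
  X.cells.preimage (fun p => {p}) Set.singleton_injective.injOn

theorem mem_verts {X : WeightedComplex} {p : Plane} : p ∈ X.verts ↔ {p} ∈ X.cells :=
  Finset.mem_preimage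

end WeightedComplex

/-- The cell `P` starts at the point `p`. -/
def StartsAt (s : ℝ) (P : Set Plane) (p : Plane) : Prop :=
  p ∈ P ∧ IsLeast (absc s '' P) (absc s p)

/-- The cell `P` ends at the point `p`. -/
def EndsAt (s : ℝ) (P : Set Plane) (p : Plane) : Prop :=
  p ∈ P ∧ IsGreatest (absc s '' P) (absc s p)

open Classical in
/-- The signed incidence number of a cell and a vertex. -/
noncomputable def incidence (s : ℝ) (P : Set Plane) (p : Plane) : ℝ :=
  (if StartsAt s P p then 1 else 0) - (if EndsAt s P p then 1 else 0)

/-- The vertical ray going down from `x` meets `P` (without its right end). -/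
def IsBelow (s α β : ℝ) (P : Set Plane) (x : Plane) : Prop :=
  (absc s x ∈ absc s '' P ∧ ∃ t ∈ absc s '' P, absc s x < t) ∧ α * absc s x + β < x 1

namespace WeightedComplex

variable {X : WeightedComplex} {s : ℝ} {α β : Set Plane → ℝ}

theorem mem_verts_of_startsAt (hG : ∀ P ∈ X.maxCells, IsGraph s P (α P) (β P)) {P : Set Plane}
    (hP : P ∈ X.maxCells) {p : Plane} (h : StartsAt s P p) : p ∈ X.verts :=
  mem_verts.mpr (X.face_mem P (mem_maxCells.mp hP).1 _ (Set.singleton_nonempty p)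
    ((hG P hP).isExposed_of_isLeast h.1 h.2))

theorem mem_verts_of_endsAt (hG : ∀ P ∈ X.maxCells, IsGraph s P (α P) (β P)) {P : Set Plane}
    (hP : P ∈ X.maxCells) {p : Plane} (h : EndsAt s P p) : p ∈ X.verts :=
  mem_verts.mpr (X.face_mem P (mem_maxCells.mp hP).1 _ (Set.singleton_nonempty p)
    ((hG P hP).isExposed_of_isGreatest h.1 h.2))

theorem dim_singleton (p : Plane) : dim {p} = 0 := by
  rw [dim, vectorSpan_singleton, finrank_bot]

/-- The vertex is the intersection of two cells, hence a face of `P`, and the only zero-dimensional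
faces of `P` are its ends. -/
theorem startsAt_or_endsAt (hG : ∀ P ∈ X.maxCells, IsGraph s P (α P) (β P)) {P : Set Plane}
    (hP : P ∈ X.maxCells) {p : Plane} (hp : p ∈ X.verts) (hpP : p ∈ P) :
    StartsAt s P p ∨ EndsAt s P p := by
  have hi : P ∩ {p} = {p} := Set.inter_eq_self_of_subset_right (Set.singleton_subset_iff.mpr hpP)
  have h := (X.inter_face P (mem_maxCells.mp hP).1 _ (mem_verts.mp hp)
    (by rw [hi]; exact Set.singleton_nonempty p)).1
  rw [hi] at h
  rcases (hG P hP).face h (Set.singleton_nonempty p) with h1 | ⟨q, -, h1, h2⟩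
  · have := (mem_maxCells.mp hP).2
    rw [← h1, dim_singleton] at this
    exact absurd this zero_ne_one
  · rw [Set.singleton_eq_singleton_iff] at h1
    subst h1
    exact h2.imp (fun h => ⟨hpP, h⟩) (fun h => ⟨hpP, h⟩)

theorem inter_subsingleton (hG : ∀ P ∈ X.maxCells, IsGraph s P (α P) (β P)) {P Q : Set Plane}
    (hP : P ∈ X.maxCells) (hQ : Q ∈ X.maxCells) (hPQ : P ≠ Q) : (P ∩ Q).Subsingleton := by
  rcases (P ∩ Q).eq_empty_or_nonempty with h | h
  · rw [h]
    exact Set.subsingleton_empty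
  · obtain ⟨h1, h2⟩ := X.inter_face P (mem_maxCells.mp hP).1 Q (mem_maxCells.mp hQ).1 h
    rcases (hG P hP).face h1 h with h3 | ⟨p, -, h3, -⟩
    · rcases (hG Q hQ).face h2 h with h4 | ⟨p, -, h4, -⟩
      · exact absurd (h3.symm.trans h4) hPQ
      · rw [h4]
        exact Set.subsingleton_singleton
    · rw [h3]
      exact Set.subsingleton_singleton

open Classical in
/-- The sum of the values of `c` at the cells below `x`. -/
noncomputable def sumBelow (X : WeightedComplex) (s : ℝ) (α β : Set Plane → ℝ)
    (c : X.maxCells → ℝ) (x : Plane) : ℝ :=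
  ∑ P : X.maxCells, if IsBelow s (α P) (β P) P x then c P else 0

theorem isClosed_support (hG : ∀ P ∈ X.maxCells, IsGraph s P (α P) (β P)) :
    IsClosed X.support :=
  X.maxCells.finite_toSet.isClosed_biUnion fun P hP => (hG P hP).isClosed_set

-- `P` has at most one point over `t`, so at most one vertex contributes. With `K` being `IsLeast`
-- or `IsGreatest`, this rewrites starts and ends over `t` as sums over vertices, where the flow
-- condition applies.
open Classical in
theorem sum_verts_indicator {P : Set Plane} {a b : ℝ} (h : IsGraph s P a b)
    (K : Set ℝ → ℝ → Prop) (hK : ∀ I t, K I t → t ∈ I)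
    (hv : ∀ p ∈ P, K (absc s '' P) (absc s p) → p ∈ X.verts) (t y : ℝ) :
    ∑ p ∈ X.verts with absc s p = t ∧ p 1 < y,
      (if p ∈ P ∧ K (absc s '' P) (absc s p) then (1 : ℝ) else 0) =
      if K (absc s '' P) t ∧ a * t + b < y then 1 else 0 := by
  split_ifs with hc
  · have hm := h.shearPoint_mem (hK _ _ hc.1)
    rw [Finset.sum_eq_single (shearPoint s t (a * t + b))]
    · rw [if_pos]
      exact ⟨hm, by simpa using hc.1⟩
    · intro q hq hne
      rw [if_neg]
      rintro ⟨hqP, -⟩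
      exact hne (h.injOn hqP hm (by simpa using (Finset.mem_filter.mp hq).2.1))
    · intro hn
      exfalso
      refine hn (Finset.mem_filter.mpr ⟨hv _ hm (by simpa using hc.1), by simp, by simpa using hc.2⟩)
  · refine Finset.sum_eq_zero fun q hq => if_neg ?_
    rintro ⟨hqP, hqK⟩
    obtain ⟨-, rfl, hy⟩ := Finset.mem_filter.mp hq
    exact hc ⟨hqK, by rwa [← h.coord_one hqP]⟩

-- Close to a point off `P` the height comparison with `P` is stable. The indicator can change only
-- when the abscissa decreases: a cell ending there is gained, a cell starting there is lost.
open Classical in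
theorem eventually_isBelow {P : Set Plane} {a b : ℝ} (h : IsGraph s P a b) {x₀ : Plane}
    (hx₀ : x₀ ∉ P) :
    ∀ᶠ x in 𝓝 x₀, (if IsBelow s a b P x then (1 : ℝ) else 0) =
      (if IsBelow s a b P x₀ then 1 else 0) + if absc s x < absc s x₀ then
        (if IsGreatest (absc s '' P) (absc s x₀) ∧ a * absc s x₀ + b < x₀ 1 then 1 else 0) -
        (if IsLeast (absc s '' P) (absc s x₀) ∧ a * absc s x₀ + b < x₀ 1 then 1 else 0)
      else 0 := by
  have hge := ((absc s).continuous.tendsto x₀).eventually (eventually_nhdsWithin_iff.mp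
    (eventually_ge_mem_rightOpen h.isClosed h.ordConnected (absc s x₀)))
  have hlt := ((absc s).continuous.tendsto x₀).eventually (eventually_nhdsWithin_iff.mp
    (eventually_lt_mem_rightOpen h.isClosed h.ordConnected (absc s x₀)))
  have hB : ∀ᶠ x in 𝓝 x₀, absc s x₀ ∈ absc s '' P →
      (a * absc s x + b < x 1 ↔ a * absc s x₀ + b < x₀ 1) := by
    by_cases ht : absc s x₀ ∈ absc s '' P
    · have c1 : ContinuousAt (fun x : Plane => a * absc s x + b) x₀ := by fun_prop
      have c2 : ContinuousAt (fun x : Plane => x 1) x₀ := continuous_coord_one.continuousAt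
      rcases lt_trichotomy (a * absc s x₀ + b) (x₀ 1) with h1 | h1 | h1
      · filter_upwards [c1.eventually_lt c2 h1] with x hx _
        simp [hx, h1]
      · exact absurd ((h.mem_iff x₀).mpr ⟨ht, h1.symm⟩) hx₀
      · filter_upwards [c2.eventually_lt c1 h1] with x hx _
        exact iff_of_false hx.not_gt h1.not_gt
    · exact Eventually.of_forall fun x hx => absurd hx ht
  filter_upwards [hge, hlt, hB] with x h1 h2 h3
  have e0 : (absc s x₀ ∈ absc s '' P ∧ ∃ t ∈ absc s '' P, absc s x₀ < t) ↔
      (absc s x₀ ∈ absc s '' P ∧ ¬ IsGreatest (absc s '' P) (absc s x₀)) := by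
    refine and_congr_right fun hm => ?_
    simp [IsGreatest, upperBounds, hm]
  have hne := h.not_isLeast_and_isGreatest (t := absc s x₀)
  have hl : IsLeast (absc s '' P) (absc s x₀) → absc s x₀ ∈ absc s '' P := fun h => h.1
  have hg : IsGreatest (absc s '' P) (absc s x₀) → absc s x₀ ∈ absc s '' P := fun h => h.1
  unfold IsBelow
  rw [e0]
  by_cases hx : absc s x < absc s x₀
  · rw [if_pos hx, h2 hx]
    by_cases hm : absc s x₀ ∈ absc s '' P
    · rw [h3 hm]
      by_cases c1 : IsLeast (absc s '' P) (absc s x₀) <;>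
      by_cases c2 : IsGreatest (absc s '' P) (absc s x₀) <;>
      by_cases c3 : a * absc s x₀ + b < x₀ 1 <;> simp [c1, c2, c3, hm]
    · have c1 := mt hl hm
      have c2 := mt hg hm
      simp [c1, c2, hm]
  · rw [if_neg hx, h1 (not_lt.mp hx), add_zero]
    by_cases hm : absc s x₀ ∈ absc s '' P
    · rw [h3 hm]
    · simp [hm]

/-- The change on moving left of `x₀` is minus the net flow, summed over the vertices vertically
below `x₀`; it vanishes vertex by vertex. -/
theorem sumBelow_eventually_eq (hG : ∀ P ∈ X.maxCells, IsGraph s P (α P) (β P))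
    {c : X.maxCells → ℝ} (hc : ∀ p ∈ X.verts, ∑ P : X.maxCells, c P * incidence s P p = 0)
    {x₀ : Plane} (hx₀ : x₀ ∉ X.support) :
    ∀ᶠ x in 𝓝 x₀, X.sumBelow s α β c x = X.sumBelow s α β c x₀ := by
  classical
  have hnot : ∀ P : X.maxCells, x₀ ∉ (P : Set Plane) := fun P h =>
    hx₀ (Set.mem_biUnion P.2 h)
  have h1 := eventually_all.mpr fun P : X.maxCells =>
    eventually_isBelow (hG P P.2) (hnot P)
  have hzero : ∑ P : X.maxCells, c P *
      ((if IsGreatest (absc s '' (P : Set Plane)) (absc s x₀) ∧ α P * absc s x₀ + β P < x₀ 1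
          then (1 : ℝ) else 0) -
        (if IsLeast (absc s '' (P : Set Plane)) (absc s x₀) ∧ α P * absc s x₀ + β P < x₀ 1
          then 1 else 0)) = 0 := by
    have h2 : ∀ P : X.maxCells,
        ((if IsGreatest (absc s '' (P : Set Plane)) (absc s x₀) ∧ α P * absc s x₀ + β P < x₀ 1
          then (1 : ℝ) else 0) -
        (if IsLeast (absc s '' (P : Set Plane)) (absc s x₀) ∧ α P * absc s x₀ + β P < x₀ 1
          then 1 else 0)) =
        -∑ p ∈ X.verts with absc s p = absc s x₀ ∧ p 1 < x₀ 1, incidence s P p := by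
      intro P
      rw [← sum_verts_indicator (X := X) (hG P P.2) IsGreatest (fun _ _ h => h.1)
        (fun p hp h => mem_verts_of_endsAt hG P.2 ⟨hp, h⟩),
        ← sum_verts_indicator (X := X) (hG P P.2) IsLeast (fun _ _ h => h.1)
        (fun p hp h => mem_verts_of_startsAt hG P.2 ⟨hp, h⟩), ← Finset.sum_sub_distrib,
        ← Finset.sum_neg_distrib]
      refine Finset.sum_congr rfl fun p _ => ?_
      rw [incidence, neg_sub]
      exact congrArg₂ _ (if_congr Iff.rfl rfl rfl) (if_congr Iff.rfl rfl rfl)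
    simp only [h2, mul_neg, Finset.mul_sum, Finset.sum_neg_distrib]
    rw [Finset.sum_comm, neg_eq_zero]
    exact Finset.sum_eq_zero fun p hp => hc p (Finset.mem_filter.mp hp).1
  filter_upwards [h1] with x hx
  have conv : ∀ y, X.sumBelow s α β c y =
      ∑ P : X.maxCells, c P * if IsBelow s (α P) (β P) P y then 1 else 0 := by
    intro y
    simp [sumBelow]
  rw [conv, conv]
  simp only [hx, mul_add, Finset.sum_add_distrib, add_eq_left]
  split_ifs with hlt
  · exact hzero
  · simp

/-- A flow on the graph of cells is determined by the sums below the points off the support. -/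
theorem eq_zero_of_sumBelow_eq (hG : ∀ P ∈ X.maxCells, IsGraph s P (α P) (β P))
    {c : X.maxCells → ℝ} {k : ℝ} (h : ∀ x ∉ X.support, X.sumBelow s α β c x = k) : c = 0 := by
  classical
  funext P
  have hP := hG P P.2
  -- an abscissa in the interior of `P` at which `P` meets no other cell
  obtain ⟨l, hl, r, hr, hlr⟩ : ∃ l ∈ absc s '' (P : Set Plane), ∃ r ∈ absc s '' (P : Set Plane),
      l < r := by
    obtain ⟨a, ha, b, hb, hab⟩ := hP.nontrivial
    rcases hab.lt_or_gt with h | h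
    exacts [⟨a, ha, b, hb, h⟩, ⟨b, hb, a, ha, h⟩]
  -- Distinct cells share at most one point, so only finitely many abscissae are excluded.
  have hfin : (⋃ Q ∈ X.maxCells.erase P, absc s '' ((P : Set Plane) ∩ Q)).Finite :=
    Set.Finite.biUnion (Finset.finite_toSet _) fun Q hQ =>
      ((inter_subsingleton hG P.2 (Finset.mem_erase.mp hQ).2
        (Finset.mem_erase.mp hQ).1.symm).image _).finite
  obtain ⟨t, ⟨hlt, htr⟩, htn⟩ := ((Set.Ioo_infinite hlr).sdiff hfin).nonempty
  have htI : t ∈ absc s '' (P : Set Plane) := hP.ordConnected.out hl hr ⟨hlt.le, htr.le⟩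
  set y₀ := α P * t + β P
  have hy₀ := hP.shearPoint_mem htI
  have hother : ∀ Q : X.maxCells, Q ≠ P → t ∈ absc s '' (Q : Set Plane) →
      α Q * t + β Q ≠ y₀ := by
    intro Q hQP hQ heq
    refine htn (Set.mem_biUnion (x := (Q : Set Plane)) ?_ ⟨shearPoint s t y₀, ⟨hy₀, ?_⟩, by simp⟩)
    · exact Finset.mem_coe.mpr (Finset.mem_erase.mpr ⟨fun h => hQP (Subtype.ext h), Q.2⟩)
    · have := (hG Q Q.2).shearPoint_mem hQ
      rwa [heq] at this
  -- For small `ε` no other cell over `t` separates the heights `y₀ - ε` and `y₀ + ε`, so the two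
  -- sums differ by `c P` alone.
  have hlow : ∀ᶠ ε in 𝓝[>] (0 : ℝ), ∀ Q : X.maxCells, Q ≠ P → t ∈ absc s '' (Q : Set Plane) →
      (α Q * t + β Q < y₀ - ε ∧ α Q * t + β Q < y₀ + ε) ∨
        (y₀ - ε < α Q * t + β Q ∧ y₀ + ε < α Q * t + β Q) := by
    refine eventually_all.mpr fun Q => ?_
    by_cases hQ : Q ≠ P ∧ t ∈ absc s '' (Q : Set Plane)
    · have hne := abs_pos.mpr (sub_ne_zero.mpr (hother Q hQ.1 hQ.2))
      filter_upwards [Ioo_mem_nhdsGT hne] with ε hε _ _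
      rcases abs_cases (α Q * t + β Q - y₀) with hh | hh
      · right
        constructor <;> linarith [hε.1, hε.2]
      · left
        constructor <;> linarith [hε.1, hε.2]
    · exact Eventually.of_forall fun ε h1 h2 => absurd ⟨h1, h2⟩ hQ
  obtain ⟨ε, hε, hε0⟩ := (hlow.and self_mem_nhdsWithin).exists
  have hε0 : 0 < ε := hε0
  have hoff : ∀ δ, (δ = ε ∨ δ = -ε) → shearPoint s t (y₀ + δ) ∉ X.support := by
    intro δ hδ hmem
    obtain ⟨Q, hQ, hm⟩ := Set.mem_iUnion₂.mp hmem
    have h1 := ((hG Q hQ).mem_iff _).mp hm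
    simp only [absc_shearPoint, shearPoint_one] at h1
    by_cases hQP : Q = P
    · rw [hQP] at h1
      have : δ = 0 := by linarith [h1.2]
      rcases hδ with rfl | rfl
      · exact hε0.ne' this
      · exact hε0.ne' (neg_eq_zero.mp this)
    · rcases hε ⟨Q, hQ⟩ (fun h => hQP (congrArg Subtype.val h)) h1.1 with hh | hh <;>
      rcases hδ with rfl | rfl <;> simp only at hh <;> linarith [hh.1, hh.2, h1.2]
  have hup := h _ (hoff ε (Or.inl rfl))
  have hdown := h _ (hoff (-ε) (Or.inr rfl))
  have hdiff : X.sumBelow s α β c (shearPoint s t (y₀ + ε)) -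
      X.sumBelow s α β c (shearPoint s t (y₀ + -ε)) = c P := by
    unfold sumBelow
    rw [← Finset.sum_sub_distrib, Finset.sum_eq_single P]
    · rw [if_pos, if_neg, sub_zero]
      · simp only [IsBelow, absc_shearPoint, shearPoint_one]
        rintro ⟨-, h⟩
        linarith
      · simp only [IsBelow, absc_shearPoint, shearPoint_one]
        exact ⟨⟨htI, r, hr, htr⟩, by linarith⟩
    · intro Q _ hQP
      by_cases hQ : t ∈ absc s '' (Q : Set Plane)
      · rw [sub_eq_zero]
        refine if_congr ?_ rfl rfl
        simp only [IsBelow, absc_shearPoint, shearPoint_one]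
        refine and_congr_right fun _ => ?_
        rcases hε Q hQP hQ with hh | hh
        · exact iff_of_true hh.2 (by linarith [hh.1])
        · exact iff_of_false hh.2.not_gt (by linarith [hh.1])
      · rw [if_neg, if_neg, sub_zero]
        all_goals
          simp only [IsBelow, absc_shearPoint]
          exact fun h => hQ h.1.1
    · exact fun h => absurd (Finset.mem_univ _) h
  rw [← hdiff, hup, hdown, sub_self]
  rfl

end WeightedComplex

end PlaneComplex

/-! ### Regions of the complement and the Euler inequality. -/

namespace PlaneComplex

open Filter Topology

namespace WeightedComplex

variable {X : WeightedComplex} {s : ℝ} {α β : Set Plane → ℝ}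

theorem component_eq_of_segment_subset {S : Set Plane} {x y : S}
    (h : segment ℝ (x : Plane) y ⊆ S) : (x : ConnectedComponents S) = y := by
  rw [ConnectedComponents.coe_eq_coe']
  exact pathComponent_subset_component y
    ((joinedIn_iff_joined x.2 y.2).mp (JoinedIn.of_segment_subset h)).symm

/-- If two points lie strictly on the same side of each line carrying a cell, the segment between
them misses all these lines, hence the support. -/
theorem component_eq_of_sides_eq (hG : ∀ P ∈ X.maxCells, IsGraph s P (α P) (β P))
    {x y : ↥X.supportᶜ}
    (hx : ∀ P ∈ X.maxCells, (x : Plane) 1 ≠ α P * absc s x + β P)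
    (hy : ∀ P ∈ X.maxCells, (y : Plane) 1 ≠ α P * absc s y + β P)
    (h : ∀ P ∈ X.maxCells, (α P * absc s x + β P < (x : Plane) 1 ↔
      α P * absc s y + β P < (y : Plane) 1)) :
    (x : ConnectedComponents ↥X.supportᶜ) = y := by
  refine component_eq_of_segment_subset ?_
  rintro _ ⟨a, b, ha, hb, hab, rfl⟩ hmem
  obtain ⟨P, hP, hz⟩ := Set.mem_iUnion₂.mp hmem
  have hz1 := (hG P hP).coord_one hz
  simp only [map_add, map_smul, PiLp.add_apply, PiLp.smul_apply, smul_eq_mul] at hz1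
  have hlin : a * ((x : Plane) 1 - (α P * absc s x + β P)) +
      b * ((y : Plane) 1 - (α P * absc s y + β P)) = 0 := by
    linear_combination hz1 - β P * hab
  have hx' := hx P hP
  have hy' := hy P hP
  have h' := h P hP
  rcases hx'.lt_or_gt with h1 | h1
  · have h2 : (y : Plane) 1 < α P * absc s y + β P :=
      lt_of_le_of_ne (not_lt.mp (mt h'.mpr h1.not_gt)) hy'
    rcases ha.eq_or_lt with rfl | ha
    · nlinarith
    · nlinarith
  · have h2 := h'.mp h1
    rcases ha.eq_or_lt with rfl | ha
    · nlinarith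
    · nlinarith

/-- A small vertical move stays in a ball off the support, and only finitely many displacements land
on a line carrying a cell. -/
theorem exists_off_lines (hG : ∀ P ∈ X.maxCells, IsGraph s P (α P) (β P)) (x : ↥X.supportᶜ) :
    ∃ y : ↥X.supportᶜ, (y : ConnectedComponents ↥X.supportᶜ) = x ∧
      ∀ P ∈ X.maxCells, (y : Plane) 1 ≠ α P * absc s y + β P := by
  obtain ⟨r, hr, hball⟩ := Metric.mem_nhds_iff.mp
    ((isClosed_support hG).isOpen_compl.mem_nhds x.2)
  have hcont : Tendsto (fun ε : ℝ => shearPoint s (absc s (x : Plane)) ((x : Plane) 1 + ε))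
      (𝓝[≠] 0) (𝓝 (x : Plane)) := by
    have hc : Continuous fun ε : ℝ => shearPoint s (absc s (x : Plane)) ((x : Plane) 1 + ε) :=
      (continuous_shearPoint s).comp
        (by fun_prop : Continuous fun ε : ℝ => (absc s (x : Plane), (x : Plane) 1 + ε))
    have := hc.tendsto 0
    rw [add_zero, shearPoint_absc] at this
    exact this.mono_left nhdsWithin_le_nhds
  have hfin : ∀ᶠ ε in 𝓝[≠] (0 : ℝ), ∀ P ∈ X.maxCells,
      ε ≠ α P * absc s x + β P - (x : Plane) 1 := by
    refine (Finset.eventually_all X.maxCells).mpr fun P _ => ?_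
    exact nhdsNE_le_cofinite _ (Set.finite_singleton _).compl_mem_cofinite
  obtain ⟨ε, h1, h2⟩ := ((hcont.eventually (Metric.ball_mem_nhds _ hr)).and hfin).exists
  refine ⟨⟨_, hball h1⟩, component_eq_of_segment_subset ?_, fun P hP h => h2 P hP ?_⟩
  · exact ((convex_ball _ _).segment_subset h1 (Metric.mem_ball_self hr)).trans hball
  · simp only [absc_shearPoint, shearPoint_one] at h
    linarith

open Classical in
theorem exists_injective_component (hG : ∀ P ∈ X.maxCells, IsGraph s P (α P) (β P)) :
    ∃ f : ConnectedComponents ↥X.supportᶜ → (X.maxCells → Bool), Function.Injective f := by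
  have h : ∀ C : ConnectedComponents ↥X.supportᶜ, ∃ y : ↥X.supportᶜ,
      (y : ConnectedComponents ↥X.supportᶜ) = C ∧
      ∀ P ∈ X.maxCells, (y : Plane) 1 ≠ α P * absc s y + β P := by
    intro C
    obtain ⟨x, rfl⟩ := ConnectedComponents.surjective_coe C
    exact exists_off_lines hG x
  choose y hy hne using h
  refine ⟨fun C P => decide (α P * absc s (y C) + β P < (y C : Plane) 1), fun C D hCD => ?_⟩
  rw [← hy C, ← hy D]
  refine component_eq_of_sides_eq hG (hne C) (hne D) fun P hP => ?_
  simpa using congrFun hCD ⟨P, hP⟩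

/-- `Nat.card` is `0` on infinite types, so `mlen` counts regions only because there are finitely
many. -/
instance finite_components (X : WeightedComplex) :
    Finite (ConnectedComponents ↥X.supportᶜ) := by
  obtain ⟨s, α, β, hG⟩ := X.exists_isGraph
  obtain ⟨f, hf⟩ := exists_injective_component hG
  exact Finite.of_injective f hf

theorem mlen_le (X : WeightedComplex) : X.mlen ≤ 2 ^ X.maxCells.card := by
  obtain ⟨s, α, β, hG⟩ := X.exists_isGraph
  obtain ⟨f, hf⟩ := exists_injective_component hG
  have := Nat.card_le_card_of_injective f hf
  simpa [mlen] using this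

theorem sumBelow_component_eq (hG : ∀ P ∈ X.maxCells, IsGraph s P (α P) (β P))
    {c : X.maxCells → ℝ} (hc : ∀ p ∈ X.verts, ∑ P : X.maxCells, c P * incidence s P p = 0)
    {x y : ↥X.supportᶜ} (hxy : (x : ConnectedComponents ↥X.supportᶜ) = y) :
    X.sumBelow s α β c x = X.sumBelow s α β c y := by
  have hloc : IsLocallyConstant fun z : ↥X.supportᶜ => X.sumBelow s α β c z :=
    IsLocallyConstant.iff_eventually_eq _ |>.mpr fun z =>
      (continuous_subtype_val.tendsto z).eventually (sumBelow_eventually_eq hG hc z.2)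
  exact hloc.apply_eq_of_isPreconnected isPreconnected_connectedComponent
    (ConnectedComponents.coe_eq_coe'.mp hxy) mem_connectedComponent

/-- The Euler inequality for the complement of the support. -/
theorem card_maxCells_lt (X : WeightedComplex) : X.maxCells.card + 1 ≤ X.mlen + X.verts.card := by
  classical
  obtain ⟨s, α, β, hG⟩ := X.exists_isGraph
  -- The incidence matrix, whose kernel is the space of flows.
  let D : (X.maxCells → ℝ) →ₗ[ℝ] (X.verts → ℝ) :=
    Matrix.mulVecLin (Matrix.of fun p P => incidence s (P : Set Plane) (p : Plane))
  have hD : ∀ c ∈ LinearMap.ker D, ∀ p ∈ X.verts,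
      ∑ P : X.maxCells, c P * incidence s P p = 0 := by
    intro c hc p hp
    have := congrFun (LinearMap.mem_ker.mp hc) ⟨p, hp⟩
    simpa [D, Matrix.mulVec, dotProduct, mul_comm] using this
  choose rep hrep using ConnectedComponents.surjective_coe (α := ↥X.supportᶜ)
  -- The factor `ℝ` adds the constant functions and accounts for the `1` in the inequality.
  let Φ : (LinearMap.ker D × ℝ) →ₗ[ℝ] (ConnectedComponents ↥X.supportᶜ → ℝ) :=
    { toFun := fun q C => X.sumBelow s α β q.1 (rep C) + q.2
      map_add' := by
        intro q r
        funext C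
        have : X.sumBelow s α β (q.1 + r.1 : X.maxCells → ℝ) (rep C) =
            X.sumBelow s α β q.1 (rep C) + X.sumBelow s α β r.1 (rep C) := by
          simp only [sumBelow, ← Finset.sum_add_distrib]
          refine Finset.sum_congr rfl fun P _ => ?_
          split_ifs <;> simp
        simp only [Prod.fst_add, Prod.snd_add, Submodule.coe_add, this, Pi.add_apply]
        ring
      map_smul' := by
        intro a q
        funext C
        have : X.sumBelow s α β (a • q.1 : X.maxCells → ℝ) (rep C) =
            a * X.sumBelow s α β q.1 (rep C) := by
          simp only [sumBelow, Finset.mul_sum]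
          refine Finset.sum_congr rfl fun P _ => ?_
          split_ifs <;> simp
        simp only [Prod.smul_fst, Prod.smul_snd, Submodule.coe_smul, this, Pi.smul_apply,
          smul_eq_mul, RingHom.id_apply]
        ring }
  have hΦ : Function.Injective Φ := by
    rw [injective_iff_map_eq_zero]
    rintro ⟨c, k⟩ h
    have hval : ∀ x ∉ X.support, X.sumBelow s α β c x = -k := by
      intro x hx
      have h1 : X.sumBelow s α β c (rep ((⟨x, hx⟩ : ↥X.supportᶜ) : ConnectedComponents _)) + k = 0 :=
        congrFun h _
      rw [sumBelow_component_eq hG (hD c c.2) (hrep _)] at h1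
      linarith
    have hc : (c : X.maxCells → ℝ) = 0 := eq_zero_of_sumBelow_eq hG hval
    -- Once `c = 0`, a single point off the support forces `k = 0`. It exists since the vertical
    -- line over abscissa `0` meets each cell at most once.
    obtain ⟨y, hy⟩ : (X.supportᶜ).Nonempty := by
      by_contra hn
      rw [Set.not_nonempty_iff_eq_empty, Set.compl_empty_iff] at hn
      have hfin : (⋃ P ∈ X.maxCells, {y : ℝ | y = β P}).Finite :=
        Set.Finite.biUnion (Finset.finite_toSet _) fun P _ => Set.finite_singleton _
      obtain ⟨y, hy⟩ := hfin.exists_notMem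
      obtain ⟨P, hP, hm⟩ := Set.mem_iUnion₂.mp (hn ▸ Set.mem_univ (shearPoint s 0 y))
      refine hy (Set.mem_biUnion hP ?_)
      simpa using (hG P hP).coord_one hm
    have hk : k = 0 := by
      have := hval y hy
      simp only [hc, sumBelow, Pi.zero_apply, ite_self, Finset.sum_const_zero] at this
      linarith
    exact Prod.ext (Subtype.ext hc) hk
  have h1 := LinearMap.finrank_le_finrank_of_injective hΦ
  have h2 := D.finrank_range_add_finrank_ker
  have h3 := (LinearMap.range D).finrank_le
  have : Fintype (ConnectedComponents ↥X.supportᶜ) := Fintype.ofFinite _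
  rw [Module.finrank_prod, Module.finrank_self, Module.finrank_fintype_fun_eq_card,
    ← Nat.card_eq_fintype_card] at h1
  simp only [Module.finrank_fintype_fun_eq_card, Fintype.card_coe] at h2 h3
  rw [mlen]
  omega

end WeightedComplex

end PlaneComplex

/-! ### Vertices of a balanced complex: degrees and counts. -/

namespace PlaneComplex

open Filter Topology

namespace WeightedComplex

variable {X : WeightedComplex} {s : ℝ} {α β : Set Plane → ℝ}

open Classical in
/-- The maximal cells that contain a point. -/
noncomputable def cellsAt (X : WeightedComplex) (p : Plane) : Finset (Set Plane) :=
  {P ∈ X.maxCells | p ∈ P}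

theorem mem_cellsAt {p : Plane} {P : Set Plane} :
    P ∈ X.cellsAt p ↔ P ∈ X.maxCells ∧ p ∈ P := by
  classical
  exact Finset.mem_filter

theorem cellsAt_nonempty {p : Plane} (hp : p ∈ X.verts) : (X.cellsAt p).Nonempty := by
  obtain ⟨Q, hQ, hpQ, hd⟩ := X.isPure _ (mem_verts.mp hp)
  exact ⟨Q, mem_cellsAt.mpr ⟨mem_maxCells.mpr ⟨hQ, hd⟩, hpQ rfl⟩⟩

/-- Directions of the cells at a vertex that witness the balancing condition. -/
theorem IsBalanced.exists_directions (hX : X.IsBalanced)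
    (hG : ∀ P ∈ X.maxCells, IsGraph s P (α P) (β P)) {p : Plane} (hp : p ∈ X.verts) :
    ∃ u : Set Plane → Plane, ∑ P ∈ X.cellsAt p, X.weight P • u P = 0 ∧
      ∀ P ∈ X.cellsAt p, 0 < X.weight P ∧ (∃ t : ℝ, 0 < t ∧ p + t • u P ∈ P) ∧
        u P 1 = α P * absc s (u P) ∧
        ((StartsAt s P p ∧ 0 < absc s (u P)) ∨ (EndsAt s P p ∧ absc s (u P) < 0)) := by
  classical
  obtain ⟨u, hu, hsum⟩ := hX p (mem_verts.mp hp)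
  refine ⟨u, by rw [cellsAt]; convert hsum, fun P hP => ?_⟩
  obtain ⟨hPm, hpP⟩ := mem_cellsAt.mp hP
  obtain ⟨hnorm, t, ht, hmem⟩ := hu P hPm hpP
  have h1 := (hG P hPm).coord_one hpP
  have h2 := (hG P hPm).coord_one hmem
  simp only [map_add, map_smul, PiLp.add_apply, PiLp.smul_apply, smul_eq_mul] at h2
  have h3 : u P 1 = α P * absc s (u P) :=
    mul_left_cancel₀ ht.ne' (by linear_combination h2 - h1)
  have hne : absc s (u P) ≠ 0 := by
    intro h0
    have : u P = 0 := ext_absc s (by rw [h0, map_zero]) (by rw [h3, h0, mul_zero]; rfl)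
    rw [this, norm_zero] at hnorm
    exact zero_ne_one hnorm
  have habs : absc s (p + t • u P) = absc s p + t * absc s (u P) := by simp
  refine ⟨X.weight_pos P (mem_maxCells.mp hPm).1 (mem_maxCells.mp hPm).2, ⟨t, ht, hmem⟩, h3, ?_⟩
  rcases startsAt_or_endsAt hG hPm hp hpP with h | h
  · refine Or.inl ⟨h, lt_of_le_of_ne ?_ hne.symm⟩
    have := h.2.2 ⟨_, hmem, rfl⟩
    rw [habs] at this
    exact le_of_mul_le_mul_left (by linarith) ht
  · refine Or.inr ⟨h, lt_of_le_of_ne ?_ hne⟩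
    have := h.2.2 ⟨_, hmem, rfl⟩
    rw [habs] at this
    exact le_of_mul_le_mul_left (by linarith) ht

/-- Under `absc s` the balancing relation becomes a vanishing sum, with positive terms for cells
starting at `p` and negative ones for cells ending there; both kinds must occur. -/
theorem IsBalanced.exists_startsAt_endsAt (hX : X.IsBalanced)
    (hG : ∀ P ∈ X.maxCells, IsGraph s P (α P) (β P)) {p : Plane} (hp : p ∈ X.verts) :
    (∃ P ∈ X.maxCells, StartsAt s P p) ∧ ∃ P ∈ X.maxCells, EndsAt s P p := by
  obtain ⟨u, hsum, hu⟩ := hX.exists_directions hG hp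
  have hsum' : ∑ P ∈ X.cellsAt p, X.weight P * absc s (u P) = 0 := by
    simpa using congrArg (absc s) hsum
  have hne := cellsAt_nonempty hp
  constructor
  · by_contra! h
    refine (Finset.sum_neg (fun P hP => ?_) hne).ne hsum'
    obtain ⟨h1, -, -, h2⟩ := hu P hP
    rcases h2 with h2 | h2
    · exact absurd h2.1 (h P (mem_cellsAt.mp hP).1)
    · exact mul_neg_of_pos_of_neg h1 h2.2
  · by_contra! h
    refine (Finset.sum_pos (fun P hP => ?_) hne).ne' hsum'
    obtain ⟨h1, -, -, h2⟩ := hu P hP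
    rcases h2 with h2 | h2
    · exact mul_pos h1 h2.2
    · exact absurd h2.1 (h P (mem_cellsAt.mp hP).1)

theorem not_startsAt_endsAt (hG : ∀ P ∈ X.maxCells, IsGraph s P (α P) (β P)) {P : Set Plane}
    (hP : P ∈ X.maxCells) {p : Plane} (h1 : StartsAt s P p) (h2 : EndsAt s P p) : False :=
  (hG P hP).not_isLeast_and_isGreatest h1.2 h2.2

theorem IsBalanced.two_le_card (hX : X.IsBalanced)
    (hG : ∀ P ∈ X.maxCells, IsGraph s P (α P) (β P)) {p : Plane} (hp : p ∈ X.verts) :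
    2 ≤ (X.cellsAt p).card := by
  obtain ⟨⟨P, hP, hPs⟩, Q, hQ, hQe⟩ := hX.exists_startsAt_endsAt hG hp
  refine Finset.one_lt_card.mpr ⟨P, mem_cellsAt.mpr ⟨hP, hPs.1⟩, Q, mem_cellsAt.mpr ⟨hQ, hQe.1⟩, ?_⟩
  rintro rfl
  exact not_startsAt_endsAt hG hP hPs hQe

/-- Two one-dimensional sets sharing two points span the same line. -/
theorem affineSpan_eq_of_mem {P Q : Set Plane} (hP : dim P = 1) (hQ : dim Q = 1) {x y : Plane}
    (hxy : x ≠ y) (hxP : x ∈ P) (hyP : y ∈ P) (hxQ : x ∈ affineSpan ℝ Q)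
    (hyQ : y ∈ affineSpan ℝ Q) : affineSpan ℝ P = affineSpan ℝ Q := by
  have key : ∀ R : Set Plane, dim R = 1 → x ∈ affineSpan ℝ R → y ∈ affineSpan ℝ R →
      affineSpan ℝ R = AffineSubspace.mk' x (ℝ ∙ (y -ᵥ x)) := by
    intro R hR hx hy
    have hne : y -ᵥ x ≠ 0 := vsub_ne_zero.mpr hxy.symm
    have hdir : (affineSpan ℝ R).direction = ℝ ∙ (y -ᵥ x) := by
      symm
      apply Submodule.eq_of_le_of_finrank_eq
      · rw [Submodule.span_singleton_le_iff_mem]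
        exact AffineSubspace.vsub_mem_direction hy hx
      · rw [finrank_span_singleton hne, direction_affineSpan]
        exact hR.symm
    rw [← hdir, AffineSubspace.mk'_eq hx]
  rw [key P hP (subset_affineSpan ℝ P hxP) (subset_affineSpan ℝ P hyP), key Q hQ hxQ hyQ]

/-- At a vertex of degree two the two cells are collinear. -/
theorem IsBalanced.exists_endsAt_of_card_eq_two (hX : X.IsBalanced)
    (hG : ∀ P ∈ X.maxCells, IsGraph s P (α P) (β P)) {P : Set Plane} (hP : P ∈ X.maxCells)
    {p : Plane} (h : StartsAt s P p) (h2 : (X.cellsAt p).card = 2) :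
    ∃ Q ∈ X.maxCells, EndsAt s Q p ∧ affineSpan ℝ Q = affineSpan ℝ P := by
  classical
  have hp := mem_verts_of_startsAt hG hP h
  obtain ⟨-, Q, hQ, hQe⟩ := hX.exists_startsAt_endsAt hG hp
  have hPQ : P ≠ Q := by
    rintro rfl
    exact not_startsAt_endsAt hG hP h hQe
  have hPm : P ∈ X.cellsAt p := mem_cellsAt.mpr ⟨hP, h.1⟩
  have hQm : Q ∈ X.cellsAt p := mem_cellsAt.mpr ⟨hQ, hQe.1⟩
  have hpair : X.cellsAt p = {P, Q} := by
    symm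
    apply Finset.eq_of_subset_of_card_le
    · intro R hR
      rcases Finset.mem_insert.mp hR with rfl | hR
      · exact hPm
      · rwa [Finset.mem_singleton.mp hR]
    · rw [h2, Finset.card_pair hPQ]
  obtain ⟨u, hsum, hu⟩ := hX.exists_directions hG hp
  rw [hpair, Finset.sum_pair hPQ] at hsum
  obtain ⟨hwP, ⟨t, ht, hmt⟩, hdP, -⟩ := hu P hPm
  obtain ⟨hwQ, ⟨r, hr, hmr⟩, hdQ, hQd⟩ := hu Q hQm
  refine ⟨Q, hQ, hQe, ?_⟩
  have hQ0 : absc s (u Q) ≠ 0 := by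
    rcases hQd with hh | hh
    exacts [hh.2.ne', hh.2.ne]
  have hQeq : u Q = (-(X.weight P / X.weight Q)) • u P := by
    have h3 : X.weight Q • u Q = -(X.weight P • u P) := eq_neg_of_add_eq_zero_right hsum
    rw [neg_smul, div_eq_inv_mul, mul_smul, ← smul_neg, ← h3, smul_smul, inv_mul_cancel₀ hwQ.ne',
      one_smul]
  refine affineSpan_eq_of_mem (mem_maxCells.mp hQ).2 (mem_maxCells.mp hP).2
    (x := p) (y := p + r • u Q) ?_ hQe.1 hmr (subset_affineSpan ℝ P h.1) ?_
  · intro hpe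
    have := congrArg (absc s) hpe
    simp only [map_add, map_smul, smul_eq_mul, left_eq_add, mul_eq_zero] at this
    exact this.elim hr.ne' hQ0
  -- The parameter comes from substituting `hQeq`: the direction of `Q` is a negative multiple of
  -- that of `P`.
  · have h4 : p + r • u Q = AffineMap.lineMap p (p + t • u P)
        (-(r * (X.weight P / X.weight Q) / t)) := by
      rw [AffineMap.lineMap_apply, hQeq]
      simp only [vsub_eq_sub, add_sub_cancel_left, vadd_eq_add, smul_smul]
      rw [add_comm]
      congr 2
      field_simp
    rw [h4]
    exact AffineMap.lineMap_mem _ (subset_affineSpan ℝ P h.1) (subset_affineSpan ℝ P hmt)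

open Classical in
/-- The vertices of degree two. -/
noncomputable def flatVerts (X : WeightedComplex) : Finset Plane :=
  {p ∈ X.verts | (X.cellsAt p).card = 2}

theorem mem_flatVerts {p : Plane} :
    p ∈ X.flatVerts ↔ p ∈ X.verts ∧ (X.cellsAt p).card = 2 := by
  classical
  exact Finset.mem_filter

theorem startsAt_unique (hG : ∀ P ∈ X.maxCells, IsGraph s P (α P) (β P)) {P : Set Plane}
    (hP : P ∈ X.maxCells) {p q : Plane} (h1 : StartsAt s P p) (h2 : StartsAt s P q) : p = q :=
  (hG P hP).injOn h1.1 h2.1 (h1.2.unique h2.2)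

theorem endsAt_unique (hG : ∀ P ∈ X.maxCells, IsGraph s P (α P) (β P)) {P : Set Plane}
    (hP : P ∈ X.maxCells) {p q : Plane} (h1 : EndsAt s P p) (h2 : EndsAt s P q) : p = q :=
  (hG P hP).injOn h1.1 h2.1 (h1.2.unique h2.2)

/-- Distinct vertices of degree two are starts of distinct cells. The leftmost cell on a line is
none of these, because a collinear cell would end at its start. Discarding them all thus loses no
line. -/
theorem IsBalanced.card_spanLines_add_le (hX : X.IsBalanced) :
    X.spanLines.card + X.flatVerts.card ≤ X.maxCells.card := by
  classical
  obtain ⟨s, α, β, hG⟩ := X.exists_isGraph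
  -- the cells that start at a vertex of degree two
  let B : Finset (Set Plane) := {P ∈ X.maxCells | ∃ p ∈ X.flatVerts, StartsAt s P p}
  have hB : X.flatVerts.card ≤ B.card := by
    have h : ∀ p ∈ X.flatVerts, ∃ P ∈ X.maxCells, StartsAt s P p := fun p hp =>
      (hX.exists_startsAt_endsAt hG (mem_flatVerts.mp hp).1).1
    choose! f hf hf' using h
    refine Finset.card_le_card_of_injOn f
      (fun p hp => Finset.mem_filter.mpr ⟨hf p hp, p, hp, hf' p hp⟩) fun p hp q hq hpq => ?_
    exact startsAt_unique hG (hf p hp) (hf' p hp) (hpq ▸ hf' q hq)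
  -- An abscissa strictly inside each cell, used only to order the cells on a line.
  have hmid : ∀ P : Set Plane, ∃ m : ℝ, P ∈ X.maxCells → (∃ a ∈ absc s '' P, a < m) ∧
      ∃ b ∈ absc s '' P, m < b := by
    intro P
    by_cases hP : P ∈ X.maxCells
    · obtain ⟨a, ha, b, hb, hab⟩ := (hG P hP).nontrivial
      rcases hab.lt_or_gt with h | h
      · obtain ⟨m, h1, h2⟩ := exists_between h
        exact ⟨m, fun _ => ⟨⟨a, ha, h1⟩, b, hb, h2⟩⟩
      · obtain ⟨m, h1, h2⟩ := exists_between h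
        exact ⟨m, fun _ => ⟨⟨b, hb, h1⟩, a, ha, h2⟩⟩
    · exact ⟨0, fun h => absurd h hP⟩
  choose m hm using hmid
  have hlines : X.spanLines ⊆ (X.maxCells \ B).image (affineSpan ℝ) := by
    intro L hL
    -- the leftmost cell on the line
    obtain ⟨P, hP, hmin⟩ := (X.cellsOn L).exists_min_image m (cellsOn_nonempty hL)
    obtain ⟨hPm, hPL⟩ := Finset.mem_filter.mp hP
    refine Finset.mem_image.mpr ⟨P, Finset.mem_sdiff.mpr ⟨hPm, fun hPB => ?_⟩, hPL⟩
    obtain ⟨-, p, hp, hs⟩ := Finset.mem_filter.mp hPB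
    obtain ⟨Q, hQ, hQe, hQP⟩ := hX.exists_endsAt_of_card_eq_two hG hPm hs (mem_flatVerts.mp hp).2
    have h1 := hmin Q (Finset.mem_filter.mpr ⟨hQ, hQP.trans hPL⟩)
    obtain ⟨a, ha, ha'⟩ := (hm P hPm).1
    obtain ⟨b, hb, hb'⟩ := (hm Q hQ).2
    have h2 := hs.2.2 ha
    have h3 := hQe.2.2 hb
    linarith
  have h1 := (Finset.card_le_card hlines).trans Finset.card_image_le
  have h2 : (X.maxCells \ B).card + B.card = X.maxCells.card :=
    Finset.card_sdiff_add_card_eq_card (Finset.filter_subset _ _)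
  omega

/-- Double counting of incidences: a cell has at most two ends, and a vertex has at least three
cells unless it is flat, when it has two and is credited one more. -/
theorem IsBalanced.card_verts_le (hX : X.IsBalanced) :
    3 * X.verts.card ≤ 2 * X.maxCells.card + X.flatVerts.card := by
  classical
  obtain ⟨s, α, β, hG⟩ := X.exists_isGraph
  have h1 : ∑ p ∈ X.verts, (X.cellsAt p).card ≤ X.maxCells.card * 2 := by
    have : ∑ p ∈ X.verts, (X.cellsAt p).card =
        ∑ P ∈ X.maxCells, (Finset.card {p ∈ X.verts | p ∈ P}) := by
      simp only [cellsAt, Finset.card_filter]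
      exact Finset.sum_comm
    rw [this, ← smul_eq_mul]
    refine Finset.sum_le_card_nsmul _ _ _ fun P hP => ?_
    have hsub : ({p ∈ X.verts | p ∈ P} : Finset Plane) ⊆
        {p ∈ X.verts | StartsAt s P p} ∪ {p ∈ X.verts | EndsAt s P p} := by
      intro p hp
      obtain ⟨hv, hpP⟩ := Finset.mem_filter.mp hp
      rw [Finset.mem_union, Finset.mem_filter, Finset.mem_filter]
      exact (startsAt_or_endsAt hG hP hv hpP).imp (⟨hv, ·⟩) (⟨hv, ·⟩)
    refine (Finset.card_le_card hsub).trans ((Finset.card_union_le _ _).trans ?_)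
    have c1 : Finset.card {p ∈ X.verts | StartsAt s P p} ≤ 1 :=
      Finset.card_le_one.mpr fun p hp q hq =>
        startsAt_unique hG hP (Finset.mem_filter.mp hp).2 (Finset.mem_filter.mp hq).2
    have c2 : Finset.card {p ∈ X.verts | EndsAt s P p} ≤ 1 :=
      Finset.card_le_one.mpr fun p hp q hq =>
        endsAt_unique hG hP (Finset.mem_filter.mp hp).2 (Finset.mem_filter.mp hq).2
    omega
  have h2 : X.verts.card * 3 ≤
      ∑ p ∈ X.verts, ((X.cellsAt p).card + if (X.cellsAt p).card = 2 then 1 else 0) := by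
    rw [← smul_eq_mul]
    refine Finset.card_nsmul_le_sum _ _ _ fun p hp => ?_
    have := hX.two_le_card hG hp
    split_ifs <;> omega
  rw [Finset.sum_add_distrib, ← Finset.card_filter] at h2
  have h3 : X.flatVerts.card = Finset.card {p ∈ X.verts | (X.cellsAt p).card = 2} := by
    rw [flatVerts]
  omega

end WeightedComplex

end PlaneComplex

/-! ### Counting lines and comparing factorization lengths. -/

namespace PlaneComplex

open Filter Topology

namespace WeightedComplex

theorem IsBalanced.card_spanLines_le {X : WeightedComplex} (hX : X.IsBalanced) :
    X.spanLines.card + 3 ≤ 3 * X.mlen := by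
  have h1 := hX.card_spanLines_add_le
  have h2 := hX.card_verts_le
  have h3 := X.card_maxCells_lt
  omega

theorem mlen_lineComplex_le (L : AffineSubspace ℝ Plane)
    (hL : Module.finrank ℝ L.direction = 1) (w : ℝ) (hw : 0 < w) :
    (lineComplex L hL w hw).mlen ≤ 2 := by
  classical
  have h : (lineComplex L hL w hw).maxCells.card ≤ 1 :=
    (Finset.card_le_card (Finset.filter_subset _ _)).trans (Finset.card_singleton _).le
  calc _ ≤ 2 ^ (lineComplex L hL w hw).maxCells.card := mlen_le _
    _ ≤ 2 ^ 1 := Nat.pow_le_pow_right two_pos h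

theorem flen_canonicalArrangement_le (X : WeightedComplex) :
    X.canonicalArrangement.flen ≤ X.spanLines.card + 1 := by
  have h : (X.canonicalArrangement.factors.map fun Z => (Z.mlen : ℤ)).sum ≤
      Multiset.card (X.canonicalArrangement.factors.map fun Z => (Z.mlen : ℤ)) • (2 : ℤ) := by
    refine Multiset.sum_le_card_nsmul _ _ fun z hz => ?_
    obtain ⟨Z, hZ, rfl⟩ := Multiset.mem_map.mp hz
    obtain ⟨L, -, rfl⟩ := Multiset.mem_map.mp hZ
    exact_mod_cast mlen_lineComplex_le _ _ _ _
  have hc : Multiset.card X.canonicalArrangement.factors = X.spanLines.card := by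
    rw [canonicalArrangement, Multiset.card_map, Finset.card_val, Finset.card_attach]
  rw [Multiset.card_map, hc, nsmul_eq_mul] at h
  rw [Factorization.flen, hc]
  linarith

/-- The set `T` is arbitrary so that the induction can remove the lines spanned by the first factor.
-/
theorem card_le_sum_card_spanLines (s : Multiset WeightedComplex) :
    ∀ T : Finset (AffineSubspace ℝ Plane), (∀ L ∈ T, ∃ Z ∈ s, L ∈ Z.spanLines) →
      T.card ≤ (s.map fun Z => Z.spanLines.card).sum := by
  classical
  induction s using Multiset.induction_on with
  | empty =>
    intro T hT
    rw [Finset.eq_empty_of_forall_notMem (s := T) fun L hL => by simpa using hT L hL]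
    simp
  | cons Z s ih =>
    intro T hT
    have h1 := ih (T \ Z.spanLines) fun L hL => by
      obtain ⟨hLT, hLZ⟩ := Finset.mem_sdiff.mp hL
      obtain ⟨W, hW, hLW⟩ := hT L hLT
      rcases Multiset.mem_cons.mp hW with rfl | hW
      · exact absurd hLW hLZ
      · exact ⟨W, hW, hLW⟩
    have h2 := Finset.card_le_card_sdiff_add_card (s := T) (t := Z.spanLines)
    rw [Multiset.map_cons, Multiset.sum_cons]
    omega

theorem weightAt_pos {X : WeightedComplex} {P : Set Plane} (hP : P ∈ X.maxCells) {x : Plane}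
    (hx : x ∈ P) : 0 < X.weightAt x := by
  classical
  refine Finset.sum_pos (fun Q hQ => ?_) ⟨P, Finset.mem_filter.mpr ⟨hP, hx⟩⟩
  have h := mem_maxCells.mp (Finset.mem_filter.mp hQ).1
  exact X.weight_pos Q h.1 h.2

theorem exists_mem_of_weightAt_ne_zero {X : WeightedComplex} {x : Plane} (h : X.weightAt x ≠ 0) :
    ∃ P ∈ X.maxCells, x ∈ P := by
  classical
  obtain ⟨P, hP, -⟩ := Finset.exists_ne_zero_of_sum_ne_zero h
  exact ⟨P, Finset.mem_filter.mp hP⟩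

theorem infinite_of_mem_maxCells {X : WeightedComplex} {P : Set Plane} (hP : P ∈ X.maxCells) :
    P.Infinite := by
  obtain ⟨s, α, β, hG⟩ := X.exists_isGraph
  obtain ⟨a, ha, b, hb, hab⟩ := (hG P hP).nontrivial
  have ho := (hG P hP).ordConnected
  refine Set.Infinite.of_image (absc s) ?_
  rcases hab.lt_or_gt with h | h
  · exact (Set.Icc_infinite h).mono (ho.out ha hb)
  · exact (Set.Icc_infinite h).mono (ho.out hb ha)

/-- Pigeonhole: finitely many cells of the factors cover an infinite part of `P`, so one of them
shares two points with `P` and spans the same line. -/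
theorem exists_mem_spanLines_of_isBalancingOf {X : WeightedComplex} {V : Factorization}
    (hV : V.IsBalancingOf X) {L : AffineSubspace ℝ Plane} (hL : L ∈ X.spanLines) :
    ∃ Z ∈ V.factors, L ∈ Z.spanLines := by
  classical
  obtain ⟨P, hP, rfl⟩ := Finset.mem_image.mp hL
  let S : Set (Set Plane) := ⋃ Z ∈ V.factors.toFinset, (Z.maxCells : Set (Set Plane))
  have hS : S.Finite := Set.Finite.biUnion (Finset.finite_toSet _) fun Z _ => Finset.finite_toSet _
  have hcover : {x ∈ P | X.weightAt x ≤ V.weightAt x} ⊆ ⋃ Q ∈ S, P ∩ Q := by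
    rintro x ⟨hxP, hx⟩
    have hpos := (weightAt_pos hP hxP).trans_le hx
    have : ∃ Z ∈ V.factors, Z.weightAt x ≠ 0 := by
      by_contra! h
      rw [Factorization.weightAt, Multiset.map_congr rfl h] at hpos
      simp at hpos
    obtain ⟨Z, hZ, hZx⟩ := this
    obtain ⟨Q, hQ, hxQ⟩ := exists_mem_of_weightAt_ne_zero hZx
    exact Set.mem_biUnion (Set.mem_biUnion (x := Z) (by simpa using hZ) hQ) ⟨hxP, hxQ⟩
  have hinf : {x ∈ P | X.weightAt x ≤ V.weightAt x}.Infinite := by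
    refine ((infinite_of_mem_maxCells hP).sdiff (Filter.mem_cofinite.mp hV)).mono ?_
    rintro x ⟨hx, hx'⟩
    exact ⟨hx, not_not.mp hx'⟩
  have : ∃ Q ∈ S, (P ∩ Q).Infinite := by
    by_contra! h
    exact hinf ((Set.Finite.biUnion hS fun Q hQ => h Q hQ).subset hcover)
  obtain ⟨Q, hQS, hQ⟩ := this
  obtain ⟨Z, hZ, hQZ⟩ := Set.mem_iUnion₂.mp hQS
  obtain ⟨x, hx, y, hy, hxy⟩ := hQ.nontrivial
  refine ⟨Z, by simpa using hZ, Finset.mem_image.mpr ⟨Q, hQZ, ?_⟩⟩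
  exact affineSpan_eq_of_mem (mem_maxCells.mp hQZ).2 (mem_maxCells.mp hP).2 hxy hx.2 hy.2
    (subset_affineSpan ℝ P hx.1) (subset_affineSpan ℝ P hy.1)

end WeightedComplex

/-- With m factors the individual bounds contribute 3m; the correction m - 1 in `flen` absorbs 3(m -
1) of it, leaving `3`, also for m = 0. -/
theorem Factorization.sum_card_spanLines_le (V : Factorization) :
    (((V.factors.map fun Z => Z.spanLines.card).sum : ℕ) : ℤ) + 3 ≤ 3 * V.flen := by
  have h : (V.factors.map fun Z => Z.spanLines.card + 3).sum ≤
      (V.factors.map fun Z => 3 * Z.mlen).sum :=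
    Multiset.sum_map_le_sum_map _ _ fun Z hZ => (V.balanced Z hZ).card_spanLines_le
  rw [Multiset.sum_map_add, Multiset.sum_map_mul_left, Multiset.map_const', Multiset.sum_replicate,
    smul_eq_mul] at h
  have hc : (V.factors.map fun Z => (Z.mlen : ℤ)).sum =
      ((V.factors.map WeightedComplex.mlen).sum : ℕ) := by
    rw [Nat.cast_multiset_sum, Multiset.map_map]
    rfl
  rw [Factorization.flen, hc]
  omega

end PlaneComplex

theorem mainTheorem5 (X : PlaneComplex.WeightedComplex) (V : PlaneComplex.Factorization)
    (hV : V.IsMinimalBalancingOf X) :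
    X.canonicalArrangement.flen ≤ 3 * V.flen := by
  have h1 := X.flen_canonicalArrangement_le
  have h2 := PlaneComplex.WeightedComplex.card_le_sum_card_spanLines V.factors X.spanLines
    fun L hL => PlaneComplex.WeightedComplex.exists_mem_spanLines_of_isBalancingOf hV.1 hL
  have h3 := V.sum_card_spanLines_le
  omega
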